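/- **Setting.** Work in max algebra: nonnegative reals with $a\oplus b=\max(a,b)$ and the usual product; matrix powers $A^r=(a^{(r)}_{ij})$ (with $A^0=I$) and products $\otimes$ are max-algebraic. For $A\in\mathbb R_+^{n\times n}$ let $\lambda(A)=\max_{1\le k\le n}(\max_i a^{(k)}_{ii})^{1/k}$ be the maximum cycle geometric mean. $A$ is *irreducible* if the digraph with edges $\{(i,j):a_{ij}\ne0\}$ has a path from every node to every node, and *definite* if $\lambda(A)=1$. A cycle is *critical* if its geometric mean equals $\lambda(A)$; the critical graph $\mathcal C(A)$ consists of all nodes and edges of critical cycles. A definite $A$ is *visualized* if $a_{ij}\le 1$ for all $i,j$ and $a_{ij}=1$ for all critical edges $(i,j)$. Let $\mathcal C_\mu$ be the strongly connected components of $\mathcal C(A)$, $\gamma_\mu$ the cyclicity of $\mathcal C_\mu$ (g.c.d. of its cycle lengths), $\gamma=\operatorname{lcm}_\mu\gamma_\mu$, and let the transient $T(A)$ be the least $T$ with $A^{r+\gamma}=A^r$ for all $r\ge T$. Two nodes $i,j$ of $\mathcal C_\mu$ are in the same *cyclic class* if $\mathcal C_\mu$ has a path from $i$ to $j$ of length divisible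 by $\gamma_\mu$. A *proper arrangement* of the cyclic classes of $\mathcal C_\mu$ lists each class exactly once, as $s_1,\dots,s_{\gamma_\mu}$, so that for each $i$, with indices taken modulo $\gamma_\mu$, there is a path in $\mathcal C_\mu$ from a node of $s_i$ to a node of $s_{i+1}$ of length $\equiv 1\pmod{\gamma_\mu}$. An $m\times n$ matrix $M$ is a *rectangular circulant* if $m_{ij}=m_{ps}$ whenever $p\equiv i+t \pmod m$ and $s\equiv j+t\pmod n$ for some integer $t$; a square $n\times n$ matrix is a *circulant* if $m_{ij}=\alpha_d$ whenever $j-i\equiv d\pmod n$, for some scalars $\alpha_d$; $M$ is a *block $k\times k$ circulant* if its rows and its columns can each be cut into $k$ nonempty groups of consecutive indices so that all entries of block $(a,b)$ equal $\alpha_d$, $d\equiv b-a\pmod k$, for some scalars $\alpha_d$. $M$ is a *Kleene star* if $M=B^*=I\oplus B\oplus B^2\oplus\cdots$ for some $B$ for which this has finite entries. **Proposition 5.5.** Let $A\in\mathbb R_+^{n\times n}$ be irreducible, definite and visualized, and let $r\ge T(A)$. Then $a^{(r)}_{ij}$, for critical $i,j$, depends only on the cyclic classes of $i$ and $j$, and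 the cyclic classes of every component can be properly arranged. Choose any proper arrangement for each component, and for components $\mathcal C_\mu,\mathcal C_\nu$ of $\mathcal C(A)$ (possibly equal), with arrangements $s_1,\dots,s_{\gamma_\mu}$ and $t_1,\dots,t_{\gamma_\nu}$, let $\tilde A^{(r)}_{\mu\nu}$ be the $\gamma_\mu\times\gamma_\nu$ matrix whose $(k,l)$ entry is the common value of $a^{(r)}_{ij}$ for $i\in s_k$, $j\in t_l$. Let $d=\gcd(\gamma_\mu,\gamma_\nu)$. Then: 1. $\tilde A^{(r)}_{\mu\nu}$ is a rectangular circulant, and $\tilde A^{(r)}_{\mu\mu}$ is a circulant. 2. For all $\mu,\nu$ there is a permutation of the cyclic classes, mapping the classes of each component among themselves, which, applied simultaneously to the rows and columns of $\tilde A^{(r)}$, turns its $(\mu,\nu)$ block into a block $d\times d$ circulant. 3. If $r$ is a multiple of $\gamma$, then each $\tilde A^{(r)}_{\mu\mu}$ is a circulant Kleene star, and all its off-diagonal entries are strictly less than $1$. -/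

import Mathlib

open scoped NNReal

namespace MaxAlg

/-! Max algebra: the semiring of nonnegative reals with `a ⊕ b = max a b` and the usual product. -/

section MatrixPowers

variable {ι : Type*} [Fintype ι] [DecidableEq ι]

/-- Max-algebraic matrix product `(A ⊗ B) i j = max_k (A i k * B k j)`. -/
noncomputable def mmul (A B : Matrix ι ι ℝ≥0) : Matrix ι ι ℝ≥0 :=
  fun i j => Finset.univ.sup fun k => A i k * B k j

/-- Max-algebraic matrix powers, `A^0` being the identity matrix. -/
noncomputable def mpow (A : Matrix ι ι ℝ≥0) : ℕ → Matrix ι ι ℝ≥0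
  | 0 => 1
  | r + 1 => mmul (mpow A r) A

/-- `lam A = max_{1 ≤ k ≤ n} (max_i (A^k) i i)^(1/k)`: the largest max-algebraic eigenvalue, which
is the maximum cycle geometric mean of `A`. -/
noncomputable def lam (A : Matrix ι ι ℝ≥0) : ℝ≥0 :=
  (Finset.Icc 1 (Fintype.card ι)).sup fun k =>
    (Finset.univ.sup fun i => mpow A k i i) ^ (1 / (k : ℝ))

/-- `A` is definite if its maximum cycle geometric mean is `1`. -/
def IsDefinite (A : Matrix ι ι ℝ≥0) : Prop := lam A = 1

/-- `M` is the Kleene star `B^* = I ⊕ B ⊕ B² ⊕ ⋯` of some matrix `B`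
(the series being convergent to a matrix with finite entries). -/
def IsKleeneStar (M : Matrix ι ι ℝ≥0) : Prop :=
  ∃ B : Matrix ι ι ℝ≥0, ∀ i j, IsLUB (Set.range fun k : ℕ => mpow B k i j) (M i j)

end MatrixPowers

section Walks

variable {V : Type*}

/-- In the digraph with edge relation `G` there is a path (nodes may repeat)
with exactly `l` edges from `i` to `j`. -/
def HasWalk (G : V → V → Prop) : ℕ → V → V → Prop
  | 0, i, j => i = j
  | l + 1, i, j => ∃ k, G i k ∧ HasWalk G l k j

theorem HasWalk.append {G : V → V → Prop} {l m : ℕ} {i j k : V}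
    (h : HasWalk G l i j) (h' : HasWalk G m j k) : HasWalk G (l + m) i k := by
  induction l generalizing i with
  | zero =>
    have h0 : i = j := h
    subst h0
    simpa using h'
  | succ l ih =>
    obtain ⟨x, hx, hw⟩ := h
    rw [Nat.succ_add]
    exact ⟨x, hx, ih hw⟩

end Walks

section CriticalGraph

variable {ι : Type*} [Fintype ι] [DecidableEq ι]

/-- `A` is irreducible: in the digraph with edges `(i, j)`, `A i j ≠ 0`, there is a path from any
node to any node. -/
def IsIrred (A : Matrix ι ι ℝ≥0) : Prop :=
  ∀ i j, ∃ l, HasWalk (fun a b => A a b ≠ 0) l i j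

/-- The cycle `(σ 0, σ 1, …, σ p = σ 0)` of length `p ≥ 1` (the values of `σ` after `p` play no
role) of the digraph of `A` is critical: its geometric mean is equal to `lam A`. -/
def IsCritCycle (A : Matrix ι ι ℝ≥0) (p : ℕ) (σ : ℕ → ι) : Prop :=
  0 < p ∧ σ p = σ 0 ∧ (∀ k < p, A (σ k) (σ (k + 1)) ≠ 0) ∧
    (∏ k ∈ Finset.range p, A (σ k) (σ (k + 1))) ^ (1 / (p : ℝ)) = lam A

/-- Critical edges. -/
def CritEdge (A : Matrix ι ι ℝ≥0) (i j : ι) : Prop :=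
  ∃ p σ, IsCritCycle A p σ ∧ ∃ k < p, σ k = i ∧ σ (k + 1) = j

/-- Critical nodes. -/
def IsCritNode (A : Matrix ι ι ℝ≥0) (i : ι) : Prop :=
  ∃ p σ, IsCritCycle A p σ ∧ ∃ k < p, σ k = i

/-- `A` is visualized: all entries are at most `1`, and critical edges have weight `1`
(the definiteness of `A` is a separate hypothesis). -/
def IsVisualized (A : Matrix ι ι ℝ≥0) : Prop :=
  (∀ i j, A i j ≤ 1) ∧ ∀ i j, CritEdge A i j → A i j = 1

/-- The nodes of the critical graph. -/
abbrev CritNode (A : Matrix ι ι ℝ≥0) : Type _ := {i : ι // IsCritNode A i}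

/-- There is a path with `l` edges from `i` to `j` in the critical graph. -/
def CritWalk (A : Matrix ι ι ℝ≥0) (l : ℕ) (i j : CritNode A) : Prop :=
  HasWalk (CritEdge A) l i.1 j.1

/-- Two critical nodes belong to the same strongly connected component. -/
def sccSetoid (A : Matrix ι ι ℝ≥0) : Setoid (CritNode A) where
  r i j := (∃ l, CritWalk A l i j) ∧ ∃ l, CritWalk A l j i
  iseqv :=
    { refl := fun _ => ⟨⟨0, rfl⟩, ⟨0, rfl⟩⟩
      symm := fun h => ⟨h.2, h.1⟩
      trans := by
        rintro x y z ⟨⟨a, ha⟩, ⟨b, hb⟩⟩ ⟨⟨c, hc⟩, ⟨d, hd⟩⟩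
        exact ⟨⟨_, HasWalk.append ha hc⟩, ⟨_, HasWalk.append hd hb⟩⟩ }

/-- The strongly connected components of the critical graph. -/
def CritComp (A : Matrix ι ι ℝ≥0) : Type _ := Quotient (sccSetoid A)

/-- The component of a critical node. -/
def comp (A : Matrix ι ι ℝ≥0) (i : CritNode A) : CritComp A := Quotient.mk (sccSetoid A) i

instance instFiniteCritComp (A : Matrix ι ι ℝ≥0) : Finite (CritComp A) :=
  inferInstanceAs (Finite (Quotient (sccSetoid A)))

noncomputable instance instFintypeCritComp (A : Matrix ι ι ℝ≥0) : Fintype (CritComp A) := Fintype.ofFinite _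

/-- The cyclicity of a component: the g.c.d. of the lengths of all its cycles. -/
noncomputable def cyc (A : Matrix ι ι ℝ≥0) (μ : CritComp A) : ℕ :=
  Nat.setGcd {l | 0 < l ∧ ∃ i, comp A i = μ ∧ CritWalk A l i i}

/-- The cyclicity of the critical graph: the l.c.m. of the cyclicities of its components. -/
noncomputable def totalCyc (A : Matrix ι ι ℝ≥0) : ℕ := Finset.univ.lcm (cyc A)

/-- `i ∼ j` when `i`, `j` lie in the same component `μ` and there is a path from `i` to `j` in the
critical graph whose length is a multiple of the cyclicity of `μ`. -/
def cycSetoid (A : Matrix ι ι ℝ≥0) : Setoid (CritNode A) where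
  r i j := comp A i = comp A j ∧ ∃ l, CritWalk A l i j ∧ cyc A (comp A i) ∣ l
  iseqv :=
    { refl := fun _ => ⟨rfl, 0, rfl, dvd_zero _⟩
      symm := by
        rintro x y ⟨h, l, hw, hd⟩
        obtain ⟨_, m, hm⟩ := Quotient.exact h
        refine ⟨h.symm, m, hm, ?_⟩
        rw [← h]
        rcases Nat.eq_zero_or_pos (l + m) with h0 | h0
        · rw [(by omega : m = 0)]
          exact dvd_zero _
        · exact (Nat.dvd_add_right hd).1
            (Nat.setGcd_dvd_of_mem ⟨h0, x, rfl, HasWalk.append hw hm⟩)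
      trans := by
        rintro x y z ⟨h, l, hw, hd⟩ ⟨h', l', hw', hd'⟩
        exact ⟨h.trans h', l + l', HasWalk.append hw hw', dvd_add hd (h ▸ hd')⟩ }

/-- The cyclic classes of the critical graph. -/
def CycClass (A : Matrix ι ι ℝ≥0) : Type _ := Quotient (cycSetoid A)

/-- The cyclic class `[i]` of a critical node. -/
def cls (A : Matrix ι ι ℝ≥0) (i : CritNode A) : CycClass A := Quotient.mk (cycSetoid A) i

/-- The component that contains a given cyclic class. -/
def CycClass.toComp {A : Matrix ι ι ℝ≥0} (s : CycClass A) : CritComp A :=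
  Quotient.lift (s := cycSetoid A) (comp A) (fun _ _ h => h.1) s

/-- Access relation `s →_t s'` between cyclic classes: some path from a node of `s` to a
node of `s'` in the critical graph has length congruent to `t` modulo the cyclicity of the
component. -/
def Accesses (A : Matrix ι ι ℝ≥0) (t : ℕ) (s s' : CycClass A) : Prop :=
  ∃ i j : CritNode A, cls A i = s ∧ cls A j = s' ∧
    ∃ l, CritWalk A l i j ∧ l ≡ t [MOD cyc A s.toComp]

/-- `s 0, s 1, …` is a proper arrangement of the cyclic classes of the component `μ`: every class
of `μ` is listed exactly once, and cyclically consecutive classes are adjacent (`→_1`). -/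
def IsProperArrangement (A : Matrix ι ι ℝ≥0) (μ : CritComp A)
    (s : Fin (cyc A μ) → CycClass A) : Prop :=
  Function.Injective s ∧ Set.range s = {c | c.toComp = μ} ∧
    ∀ a b : Fin (cyc A μ), (b : ℕ) ≡ a + 1 [MOD cyc A μ] → Accesses A 1 (s a) (s b)

/-- The transient `T(A)`: the least `T` with `A^(r+γ) = A^r` for all `r ≥ T`, where `γ` is the
cyclicity of the critical graph (`⊤` if there were no such `T`). -/
noncomputable def transient (A : Matrix ι ι ℝ≥0) : ℕ∞ :=
  ⨅ T ∈ {T : ℕ | ∀ r ≥ T, mpow A (r + totalCyc A) = mpow A r}, (T : ℕ∞)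

/-- The entry of the reduced matrix `Ã^(r)` at a pair of cyclic classes: the value of `A^r` at
nodes taken from these classes. -/
noncomputable def reducedEntry (A : Matrix ι ι ℝ≥0) (r : ℕ) (s t : CycClass A) : ℝ≥0 :=
  mpow A r (Quotient.out (s := cycSetoid A) s).1 (Quotient.out (s := cycSetoid A) t).1

/-- The block `Ã^(r)_{μν}` of the reduced matrix, for arrangements `s` and `t` of the cyclic
classes of `μ` and `ν`. -/
noncomputable def reducedBlock (A : Matrix ι ι ℝ≥0) (r : ℕ) {m n : ℕ}
    (s : Fin m → CycClass A) (t : Fin n → CycClass A) : Matrix (Fin m) (Fin n) ℝ≥0 :=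
  fun a b => reducedEntry A r (s a) (t b)

end CriticalGraph

section Circulants

/-- Circulant: `M i j = α d` whenever `j - i ≡ d` modulo `n`. -/
def IsCirculant {n : ℕ} (M : Matrix (Fin n) (Fin n) ℝ≥0) : Prop :=
  ∃ α : ZMod n → ℝ≥0, ∀ i j : Fin n, M i j = α (((j : ℕ) : ZMod n) - ((i : ℕ) : ZMod n))

/-- Rectangular circulant: `M i j = M p s` whenever `p ≡ i + t` modulo `m` and `s ≡ j + t`
modulo `n`. -/
def IsRectCirculant {m n : ℕ} (M : Matrix (Fin m) (Fin n) ℝ≥0) : Prop :=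
  ∀ (i p : Fin m) (j s : Fin n) (t : ℕ),
    (p : ℕ) ≡ i + t [MOD m] → (s : ℕ) ≡ j + t [MOD n] → M i j = M p s

/-- Block `k × k` circulant: the rows and the columns are cut into `k` nonempty groups of
consecutive indices (`ρ` and `κ` give the group of a row and of a column) such that block `(a, b)`
is constant with value `α d` for `b - a ≡ d` modulo `k`. -/
def IsBlockCirculant {m n : ℕ} (k : ℕ) (M : Matrix (Fin m) (Fin n) ℝ≥0) : Prop :=
  ∃ (α : ZMod k → ℝ≥0) (ρ : Fin m → Fin k) (κ : Fin n → Fin k),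
    Monotone ρ ∧ Function.Surjective ρ ∧ Monotone κ ∧ Function.Surjective κ ∧
      ∀ i j, M i j = α (((κ j : ℕ) : ZMod k) - ((ρ i : ℕ) : ZMod k))

end Circulants

end MaxAlg

/-! Since all entries are at most 1 and critical edges have weight 1, a critical walk of length `l`
from `i` to `j` gives `mpow A l i j = 1`. Prolonging optimal walks at both ends by critical walks
therefore loses no weight, and past the transient an added length divisible by γ = `totalCyc A` does
not change the power (`mpow_le_of_critWalk`).

Critical walks between two given nodes are flexible: their lengths can be adjusted to every residue
mod γ compatible with the cyclicity of the component (`CritWalk.exists_modEq_totalCyc`). So entries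
depend only on cyclic classes, and moving both classes `t` places forward preserves them, which is
the rectangular circulant property. By the Chinese remainder theorem such a matrix depends only on
the index difference mod the gcd, and grouping indices by residue gives the block circulant.

If γ divides `r`, then `A^(2r) = A^r` and the diagonal is 1, so a diagonal block is its own Kleene
star. An entry 1 inside a component comes from a walk of weight 1 that closes up into a critical
cycle; its length `r` then forces equal classes. -/

namespace MaxAlg

/-! ### Walks and vertex sequences. -/

section Walks

variable {V : Type*} {G : V → V → Prop}

theorem hasWalk_one {i j : V} (h : G i j) : HasWalk G 1 i j := ⟨j, h, rfl⟩

theorem hasWalk_of_sequence {σ : ℕ → V} {p : ℕ} (hσ : ∀ k < p, G (σ k) (σ (k + 1))) {a l : ℕ}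
    (hal : a + l ≤ p) : HasWalk G l (σ a) (σ (a + l)) := by
  induction l with
  | zero => rfl
  | succ l ih => exact (ih (by omega)).append (hasWalk_one (hσ (a + l) (by omega)))

theorem HasWalk.exists_sequence {l : ℕ} {i j : V} (h : HasWalk G l i j) :
    ∃ σ : ℕ → V, σ 0 = i ∧ σ l = j ∧ ∀ k < l, G (σ k) (σ (k + 1)) := by
  induction l generalizing i with
  | zero => exact ⟨fun _ => i, rfl, h, by simp⟩
  | succ l ih =>
    obtain ⟨x, hx, hw⟩ := h
    obtain ⟨σ, h0, hl, hσ⟩ := ih hw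
    refine ⟨fun k => Nat.casesOn k i σ, rfl, hl, ?_⟩
    rintro (_ | k) hk
    · simpa [h0] using hx
    · exact hσ k (by omega)

end Walks

theorem mul_le_mmul {ι : Type*} [Fintype ι] (A B : Matrix ι ι ℝ≥0) (i j k : ι) :
    A i j * B j k ≤ mmul A B i k :=
  Finset.le_sup (f := fun x => A i x * B x k) (Finset.mem_univ j)

/-! ### Max-algebraic powers, entries bounded by 1, Kleene stars. -/

section MatrixPowers

variable {ι : Type*} [Fintype ι] [DecidableEq ι] {A : Matrix ι ι ℝ≥0}

theorem mpow_one (A : Matrix ι ι ℝ≥0) : mpow A 1 = A := by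
  ext i j
  congr 1
  refine le_antisymm (Finset.sup_le fun k _ => ?_) ?_
  · rcases eq_or_ne i k with rfl | h
    · simp [mpow]
    · simp [mpow, Matrix.one_apply_ne h]
  · simpa [mpow] using mul_le_mmul (mpow A 0) A i i j

theorem mpow_mul_le (l m : ℕ) (i j k : ι) :
    mpow A l i j * mpow A m j k ≤ mpow A (l + m) i k := by
  induction m generalizing k with
  | zero =>
    rcases eq_or_ne j k with rfl | h
    · simp [mpow]
    · simp [mpow, Matrix.one_apply_ne h]
  | succ m ih =>
    change _ * Finset.univ.sup _ ≤ _
    rw [NNReal.mul_finset_sup]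
    refine Finset.sup_le fun x _ => ?_
    rw [← mul_assoc]
    exact (mul_le_mul_left (ih x) _).trans (mul_le_mmul (mpow A (l + m)) A i x k)

theorem mpow_le_one (h : ∀ i j, A i j ≤ 1) (l : ℕ) (i j : ι) : mpow A l i j ≤ 1 := by
  induction l generalizing j with
  | zero =>
    rcases eq_or_ne i j with rfl | h
    · simp [mpow]
    · simp [mpow, Matrix.one_apply_ne h]
  | succ l ih => exact Finset.sup_le fun x _ => mul_le_one' (ih x) (h x j)

/-- The maximum is attained, and a product of factors at most 1 equals 1 only if every factor does.
-/
theorem hasWalk_of_mpow_eq_one (h : ∀ i j, A i j ≤ 1) {l : ℕ} {i j : ι}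
    (h1 : mpow A l i j = 1) : HasWalk (fun a b => A a b = 1) l i j := by
  induction l generalizing j with
  | zero =>
    by_contra hij
    rw [mpow, Matrix.one_apply_ne hij] at h1
    exact zero_ne_one h1
  | succ l ih =>
    obtain ⟨x, -, hx⟩ := Finset.exists_mem_eq_sup Finset.univ ⟨i, Finset.mem_univ i⟩
      fun x => mpow A l i x * A x j
    change Finset.univ.sup _ = _ at h1
    rw [hx] at h1
    have hl : mpow A l i x = 1 := by
      refine le_antisymm (mpow_le_one h l i x) ?_
      rw [← h1]
      exact mul_le_of_le_one_right' (h x j)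
    rw [hl, one_mul] at h1
    exact (ih hl).append (hasWalk_one h1)

theorem mpow_eq_one_of_hasWalk (h : ∀ i j, A i j ≤ 1) {l : ℕ} {i j : ι}
    (hw : HasWalk (fun a b => A a b = 1) l i j) : mpow A l i j = 1 := by
  induction l generalizing i with
  | zero =>
    have h0 : i = j := hw
    subst h0
    simp [mpow]
  | succ l ih =>
    obtain ⟨x, hx, hw⟩ := hw
    refine le_antisymm (mpow_le_one h _ _ _) ?_
    have := mpow_mul_le (A := A) 1 l i x j
    rwa [mpow_one, hx, ih hw, one_mul, Nat.add_comm] at this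

theorem mpow_add_mul_period {γ r : ℕ} (h : ∀ q ≥ r, mpow A (q + γ) = mpow A q) (k : ℕ) :
    mpow A (r + γ * k) = mpow A r := by
  induction k with
  | zero => rfl
  | succ k ih => rw [Nat.mul_succ, ← add_assoc, h _ (by omega), ih]

/-- `M` is its own star: every power is bounded by `M`, and `M` is the first power. -/
theorem isKleeneStar_of_idempotent {M : Matrix ι ι ℝ≥0} (hdiag : ∀ i, M i i = 1)
    (hM : ∀ i j k, M i j * M j k ≤ M i k) : IsKleeneStar M := by
  refine ⟨M, fun i j => ⟨?_, fun b hb => hb ⟨1, by simp only [mpow_one]⟩⟩⟩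
  rintro _ ⟨k, rfl⟩
  change mpow M k i j ≤ M i j
  induction k generalizing j with
  | zero =>
    rcases eq_or_ne i j with rfl | h
    · simp [mpow, hdiag]
    · simp [mpow, Matrix.one_apply_ne h]
  | succ k ih => exact Finset.sup_le fun x _ => (mul_le_mul_left (ih x) _).trans (hM i x j)

end MatrixPowers

/-! ### Rectangular circulants, diagonals modulo the gcd, block form. -/

section Circulants

theorem IsRectCirculant.exists_diagonal {m n d : ℕ} {M : Matrix (Fin m) (Fin n) ℝ≥0}
    (hM : IsRectCirculant M) (hd : d = Nat.gcd m n) :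
    ∃ α : ZMod d → ℝ≥0, ∀ i j, M i j = α (((j : ℕ) : ZMod d) - ((i : ℕ) : ZMod d)) := by
  classical
  have key : ∀ (i i' : Fin m) (j j' : Fin n),
      ((j : ℕ) : ZMod d) - ((i : ℕ) : ZMod d) = ((j' : ℕ) : ZMod d) - ((i' : ℕ) : ZMod d) →
      M i j = M i' j' := by
    intro i i' j j' h
    have hm : ((m : ℕ) : ZMod d) = 0 :=
      (ZMod.natCast_eq_zero_iff _ _).2 (hd ▸ Nat.gcd_dvd_left m n)
    have hn : ((n : ℕ) : ZMod d) = 0 :=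
      (ZMod.natCast_eq_zero_iff _ _).2 (hd ▸ Nat.gcd_dvd_right m n)
    -- The shift sought satisfies `t ≡ i' - i` mod `m` and `t ≡ j' - j` mod `n`; adding `m` and `n`
    -- keeps both in ℕ. Agreement mod the gcd is the solvability condition of the Chinese remainder
    -- theorem.
    have hc : (i' : ℕ) + (m - i) ≡ j' + (n - j) [MOD Nat.gcd m n] := by
      rw [← hd, ← ZMod.natCast_eq_natCast_iff]
      push_cast [Nat.cast_sub i.2.le, Nat.cast_sub j.2.le]
      rw [hm, hn]
      linear_combination h
    obtain ⟨t, ht, ht'⟩ := Nat.chineseRemainder' hc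
    refine hM i i' j j' t ?_ ?_
    · have := (ht.add_left (i : ℕ)).symm
      rw [show (i : ℕ) + (i' + (m - i)) = i' + m by omega] at this
      exact (Nat.ModEq.symm (by simp [Nat.ModEq])).trans this
    · have := (ht'.add_left (j : ℕ)).symm
      rw [show (j : ℕ) + (j' + (n - j)) = j' + n by omega] at this
      exact (Nat.ModEq.symm (by simp [Nat.ModEq])).trans this
  -- The default 0 is used only when there are no index pairs at all.
  refine ⟨fun z => if h : ∃ ij : Fin m × Fin n, ((ij.2 : ℕ) : ZMod d) - ((ij.1 : ℕ) : ZMod d) = z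
    then M h.choose.1 h.choose.2 else 0, fun i j => ?_⟩
  have h : ∃ ij : Fin m × Fin n, ((ij.2 : ℕ) : ZMod d) - ((ij.1 : ℕ) : ZMod d) =
    ((j : ℕ) : ZMod d) - ((i : ℕ) : ZMod d) := ⟨(i, j), rfl⟩
  simp only [dif_pos h]
  exact (key _ _ _ _ h.choose_spec).symm

theorem IsRectCirculant.isCirculant {n : ℕ} {M : Matrix (Fin n) (Fin n) ℝ≥0}
    (hM : IsRectCirculant M) : IsCirculant M :=
  hM.exists_diagonal (Nat.gcd_self n).symm

/-- The indices `0, …, m - 1` can be reordered so that residues modulo a divisor `d` of `m` occur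
in `d` consecutive groups. -/
theorem exists_perm_grouping_residues {m d : ℕ} (hm : 0 < m) (hd : d ∣ m) :
    ∃ (P : Equiv.Perm (Fin m)) (ρ : Fin m → Fin d), Monotone ρ ∧ Function.Surjective ρ ∧
      ∀ i, ((P i : ℕ) : ZMod d) = ((ρ i : ℕ) : ZMod d) := by
  obtain ⟨q, rfl⟩ := hd
  have hq : 0 < q := Nat.pos_of_mul_pos_left hm
  -- The permutation is `q * a + b ↦ d * b + a` for `a < d`, `b < q`: the group `a` becomes the
  -- residue mod `d`.
  refine ⟨finProdFinEquiv.symm.trans ((Equiv.prodComm _ _).trans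
    (finProdFinEquiv.trans (finCongr (Nat.mul_comm q d)))),
    fun i => (finProdFinEquiv.symm i).1, fun i j hij => ?_, fun a => ?_, fun i => ?_⟩
  · exact Nat.div_le_div_right hij
  · exact ⟨finProdFinEquiv (a, ⟨0, hq⟩), by simp⟩
  · simp [finProdFinEquiv]

end Circulants

/-! ### Critical walks and their components. -/

section CriticalGraph

variable {ι : Type*} [Fintype ι] [DecidableEq ι] {A : Matrix ι ι ℝ≥0}

theorem IsCritCycle.critEdge {p : ℕ} {σ : ℕ → ι} (h : IsCritCycle A p σ) {k : ℕ} (hk : k < p) :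
    CritEdge A (σ k) (σ (k + 1)) :=
  ⟨p, σ, h, k, hk, rfl, rfl⟩

theorem CritEdge.exists_hasWalk_symm {i j : ι} (h : CritEdge A i j) :
    ∃ l, HasWalk (CritEdge A) l j i := by
  obtain ⟨p, σ, hσ, k, hk, rfl, rfl⟩ := h
  have h1 := hasWalk_of_sequence (fun _ => hσ.critEdge) (a := k + 1) (l := p - (k + 1)) (by omega)
  have h2 := hasWalk_of_sequence (fun _ => hσ.critEdge) (a := 0) (l := k) (by omega)
  rw [Nat.add_sub_cancel' (by omega : k + 1 ≤ p), hσ.2.1] at h1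
  rw [Nat.zero_add] at h2
  exact ⟨_, h1.append h2⟩

theorem CritEdge.isCritNode_right {i j : ι} (h : CritEdge A i j) : IsCritNode A j := by
  obtain ⟨p, σ, hσ, k, hk, rfl, rfl⟩ := h
  rcases (by omega : k + 1 < p ∨ k + 1 = p) with h | h
  · exact ⟨p, σ, hσ, k + 1, h, rfl⟩
  · exact ⟨p, σ, hσ, 0, by omega, by rw [h, hσ.2.1]⟩

theorem IsCritNode.exists_critEdge {i : ι} (h : IsCritNode A i) : ∃ j, CritEdge A i j := by
  obtain ⟨p, σ, hσ, k, hk, rfl⟩ := h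
  exact ⟨_, hσ.critEdge hk⟩

/-- Each critical edge lies on a critical cycle, whose other edges lead back. Hence a critical walk
never leaves its component. -/
theorem HasWalk.exists_symm_of_critEdge {l : ℕ} {i j : ι} (h : HasWalk (CritEdge A) l i j) :
    ∃ m, HasWalk (CritEdge A) m j i := by
  induction l generalizing i with
  | zero => exact ⟨0, Eq.symm h⟩
  | succ l ih =>
    obtain ⟨x, hx, hw⟩ := h
    obtain ⟨m, hm⟩ := ih hw
    obtain ⟨q, hq⟩ := hx.exists_hasWalk_symm
    exact ⟨_, hm.append hq⟩

variable {i j k : CritNode A} {l m : ℕ}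

theorem CritWalk.trans (h : CritWalk A l i j) (h' : CritWalk A m j k) :
    CritWalk A (l + m) i k :=
  HasWalk.append h h'

theorem CritWalk.exists_symm (h : CritWalk A l i j) : ∃ m, CritWalk A m j i :=
  HasWalk.exists_symm_of_critEdge h

theorem CritWalk.comp_eq (h : CritWalk A l i j) : comp A i = comp A j :=
  Quotient.sound ⟨⟨l, h⟩, h.exists_symm⟩

theorem exists_critWalk_of_comp_eq (h : comp A i = comp A j) : ∃ l, CritWalk A l i j :=
  (Quotient.exact h).1

theorem exists_critWalk_one (i : CritNode A) : ∃ j, CritWalk A 1 i j := by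
  obtain ⟨j, hj⟩ := i.2.exists_critEdge
  exact ⟨⟨j, hj.isCritNode_right⟩, hasWalk_one hj⟩

/-! ### Cyclicity and lengths of critical walks. -/

theorem cyc_dvd_of_critWalk_self (h : CritWalk A l i i) : cyc A (comp A i) ∣ l := by
  rcases Nat.eq_zero_or_pos l with rfl | hl
  · exact dvd_zero _
  · exact Nat.setGcd_dvd_of_mem ⟨hl, i, rfl, h⟩

theorem cyc_pos (A : Matrix ι ι ℝ≥0) (μ : CritComp A) : 0 < cyc A μ := by
  obtain ⟨i, rfl⟩ := Quotient.exists_rep μ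
  obtain ⟨j, hj⟩ := exists_critWalk_one i
  obtain ⟨l, hl⟩ := hj.exists_symm
  exact Nat.pos_of_dvd_of_pos (cyc_dvd_of_critWalk_self (hj.trans hl)) (by omega)

/-- A common return walk closes both walks into cycles. -/
theorem CritWalk.length_modEq (h : CritWalk A l i j) (h' : CritWalk A m i j) :
    l ≡ m [MOD cyc A (comp A i)] := by
  obtain ⟨q, hq⟩ := h.exists_symm
  refine Nat.ModEq.add_right_cancel' q ?_
  exact ((Nat.modEq_zero_iff_dvd.2 (cyc_dvd_of_critWalk_self (h.trans hq)))).trans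
    (Nat.modEq_zero_iff_dvd.2 (cyc_dvd_of_critWalk_self (h'.trans hq))).symm

/-- Cycles at one node already determine the cyclicity: a cycle of length `l` at `j` turns the
closed walk `i → j → i` of length `p + q` into one of length `p + l + q`. -/
theorem cyc_dvd_setGcd (i : CritNode A) :
    Nat.setGcd {l | CritWalk A l i i} ∣ cyc A (comp A i) := by
  refine Nat.dvd_setGcd_iff.2 ?_
  rintro l ⟨-, j, hj, hl⟩
  obtain ⟨p, hp⟩ := exists_critWalk_of_comp_eq hj.symm
  obtain ⟨q, hq⟩ := exists_critWalk_of_comp_eq hj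
  have h1 : Nat.setGcd {l | CritWalk A l i i} ∣ p + q :=
    Nat.setGcd_dvd_of_mem (show CritWalk A _ i i from hp.trans hq)
  have h2 : Nat.setGcd {l | CritWalk A l i i} ∣ p + l + q :=
    Nat.setGcd_dvd_of_mem (show CritWalk A _ i i from (hp.trans hl).trans hq)
  rw [show p + l + q = p + q + l by omega] at h2
  exact (Nat.dvd_add_right h1).1 h2

/-- Lengths of closed walks at `i` form an additive submonoid of ℕ, which contains all large
multiples of its gcd. -/
theorem exists_forall_ge_critWalk_self (i : CritNode A) :
    ∃ N, ∀ l ≥ N, cyc A (comp A i) ∣ l → CritWalk A l i i := by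
  obtain ⟨N, hN⟩ := Nat.exists_mem_closure_of_ge {l | CritWalk A l i i}
  let S : AddSubmonoid ℕ :=
    { carrier := {l | CritWalk A l i i}
      add_mem' := fun h h' => CritWalk.trans h h'
      zero_mem' := rfl }
  exact ⟨N, fun l hl hd => AddSubmonoid.closure_le (S := S).2 (fun _ h => h)
    (hN l hl ((cyc_dvd_setGcd i).trans hd))⟩

theorem cyc_dvd_totalCyc (A : Matrix ι ι ℝ≥0) (μ : CritComp A) : cyc A μ ∣ totalCyc A :=
  Finset.dvd_lcm (Finset.mem_univ μ)

theorem totalCyc_pos (A : Matrix ι ι ℝ≥0) : 0 < totalCyc A :=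
  Nat.pos_of_ne_zero fun h => by
    obtain ⟨μ, -, hμ⟩ := Finset.lcm_eq_zero_iff.1 h
    exact (cyc_pos A μ).ne' hμ

/-- A walk in the critical graph can be replaced by one whose length has any residue modulo
`totalCyc A` that is compatible with its residue modulo the cyclicity of the component. -/
theorem CritWalk.exists_modEq_totalCyc (h : CritWalk A l i j) {c : ℕ}
    (hc : l ≡ c [MOD cyc A (comp A i)]) :
    ∃ l', CritWalk A l' i j ∧ l' ≡ c [MOD totalCyc A] := by
  obtain ⟨N, hN⟩ := exists_forall_ge_critWalk_self i
  have hγ := totalCyc_pos A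
  have hle : N + l ≤ totalCyc A * (N + l) := Nat.le_mul_of_pos_left _ hγ
  have hmod : c + totalCyc A * (N + l) ≡ c [MOD totalCyc A] := by simp [Nat.ModEq]
  -- This length exceeds `l` by at least `N`, so the excess is realised by a closed walk at `i`.
  refine ⟨c + totalCyc A * (N + l), ?_, hmod⟩
  have hw := hN (c + totalCyc A * (N + l) - l) (by omega) <|
    (Nat.modEq_iff_dvd' (by omega)).1
      (hc.trans (hmod.of_dvd (cyc_dvd_totalCyc A _)).symm)
  have := hw.trans h
  rwa [Nat.sub_add_cancel (by omega)] at this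

/-! ### Cyclic classes and proper arrangements. -/

theorem cls_eq_iff : cls A i = cls A j ↔
    ∃ l, CritWalk A l i j ∧ cyc A (comp A i) ∣ l :=
  ⟨fun h => (Quotient.exact h).2, fun ⟨l, hw, hd⟩ => Quotient.sound ⟨hw.comp_eq, l, hw, hd⟩⟩

/-- The representative of a cyclic class that is used in `reducedEntry`. -/
noncomputable def CycClass.rep (c : CycClass A) : CritNode A := Quotient.out (s := cycSetoid A) c

theorem CycClass.cls_rep (c : CycClass A) : cls A c.rep = c := Quotient.out_eq _

theorem CycClass.comp_rep (c : CycClass A) : comp A c.rep = c.toComp :=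
  congrArg CycClass.toComp c.cls_rep

theorem Accesses.critWalk_rep {t : ℕ} {c c' : CycClass A} (h : Accesses A t c c') :
    ∃ l, CritWalk A l c.rep c'.rep ∧ l ≡ t [MOD cyc A c.toComp] := by
  obtain ⟨i, j, rfl, rfl, l, hl, ht⟩ := h
  obtain ⟨p, hp, hpd⟩ := cls_eq_iff.1 (cls A i).cls_rep
  obtain ⟨q, hq, hqd⟩ := cls_eq_iff.1 (cls A j).cls_rep.symm
  rw [CycClass.comp_rep] at hpd
  rw [← hl.comp_eq] at hqd
  refine ⟨_, (hp.trans hl).trans hq, ?_⟩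
  simpa using ((Nat.modEq_zero_iff_dvd.2 hpd).add ht).add (Nat.modEq_zero_iff_dvd.2 hqd)

/-- Follow critical edges from a node `i`. The class of a node is determined by the residue of the
length of any critical walk from `i` to it, so the first `cyc` nodes met represent each class once.
-/
theorem exists_isProperArrangement (A : Matrix ι ι ℝ≥0) (μ : CritComp A) :
    ∃ s : Fin (cyc A μ) → CycClass A, IsProperArrangement A μ s := by
  obtain ⟨i, rfl⟩ := Quotient.exists_rep μ
  change ∃ s : Fin (cyc A (comp A i)) → CycClass A, IsProperArrangement A (comp A i) s
  choose next hnext using fun i : CritNode A => exists_critWalk_one i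
  have hf : ∀ k, CritWalk A k i (next^[k] i) := by
    intro k
    induction k with
    | zero => rfl
    | succ k ih =>
      rw [Function.iterate_succ_apply']
      exact ih.trans (hnext _)
  have hcls : ∀ {k l : ℕ} {j : CritNode A}, CritWalk A l i j → l ≡ k [MOD cyc A (comp A i)] →
      cls A (next^[k] i) = cls A j := by
    intro k l j hl hk
    have hc := (hf k).comp_eq
    obtain ⟨m, hm⟩ := exists_critWalk_of_comp_eq (hc.symm.trans hl.comp_eq)
    refine cls_eq_iff.2 ⟨m, hm, ?_⟩
    rw [← hc]
    refine Nat.modEq_zero_iff_dvd.1 (Nat.ModEq.add_left_cancel' k ?_)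
    exact (((hf k).trans hm).length_modEq hl).trans hk
  refine ⟨fun k => cls A (next^[k] i), fun a b hab => ?_, ?_, fun a b hab => ?_⟩
  · obtain ⟨m, hm, hd⟩ := cls_eq_iff.1 hab
    rw [← (hf a).comp_eq] at hd
    have h := ((hf a).trans hm).length_modEq (hf b)
    have h' : (a : ℕ) + m ≡ a [MOD cyc A (comp A i)] := (Nat.modEq_zero_iff_dvd.2 hd).add_left _
    exact Fin.ext ((h'.symm.trans h).eq_of_lt_of_lt a.2 b.2)
  · ext c
    constructor
    · rintro ⟨k, rfl⟩
      exact (hf k).comp_eq.symm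
    · intro hc
      obtain ⟨j, rfl⟩ := Quotient.exists_rep c
      obtain ⟨l, hl⟩ := exists_critWalk_of_comp_eq (i := i) (j := j) (Eq.symm hc)
      exact ⟨⟨l % cyc A (comp A i), Nat.mod_lt _ (cyc_pos A _)⟩,
        hcls hl (Nat.mod_modEq _ _).symm⟩
  · refine ⟨next^[a] i, next (next^[a] i), rfl, ?_, 1, hnext _, Nat.ModEq.refl _⟩
    exact (hcls ((hf a).trans (hnext _)) hab.symm).symm

section Arrangement

variable {μ : CritComp A} {s : Fin (cyc A μ) → CycClass A}

theorem IsProperArrangement.toComp_eq (hs : IsProperArrangement A μ s) (a : Fin (cyc A μ)) :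
    (s a).toComp = μ := by
  have : s a ∈ {c : CycClass A | c.toComp = μ} := hs.2.1 ▸ Set.mem_range_self a
  exact this

theorem IsProperArrangement.exists_critWalk (hs : IsProperArrangement A μ s)
    {a b : Fin (cyc A μ)} {t : ℕ} (h : (b : ℕ) ≡ a + t [MOD cyc A μ]) :
    ∃ l, CritWalk A l (s a).rep (s b).rep ∧ l ≡ t [MOD cyc A μ] := by
  induction t generalizing b with
  | zero =>
    obtain rfl : b = a := Fin.ext (Nat.ModEq.eq_of_lt_of_lt h b.2 a.2)
    exact ⟨0, rfl, rfl⟩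
  | succ t ih =>
    let q : Fin (cyc A μ) := ⟨(a + t) % cyc A μ, Nat.mod_lt _ (cyc_pos A μ)⟩
    have hq : (q : ℕ) ≡ a + t [MOD cyc A μ] := Nat.mod_modEq _ _
    obtain ⟨l, hl, hlt⟩ := ih hq
    obtain ⟨m, hm, hmt⟩ := (hs.2.2 q b (h.trans (hq.add_right 1).symm)).critWalk_rep
    rw [hs.toComp_eq] at hmt
    exact ⟨l + m, hl.trans hm, hlt.add hmt⟩

end Arrangement

/-! ### Powers past the transient at critical nodes. -/

theorem exists_period_of_transient_le {r : ℕ} (hr : transient A ≤ (r : ℕ∞)) :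
    ∀ q ≥ r, mpow A (q + totalCyc A) = mpow A q := by
  by_contra hcon
  have h : ((r + 1 : ℕ) : ℕ∞) ≤ transient A := by
    refine le_iInf₂ fun T hT => Nat.cast_le.2 ?_
    by_contra hlt
    exact hcon fun q hq => hT q (by omega)
  have := Nat.cast_le.1 (h.trans hr)
  omega

theorem CritWalk.mpow_eq_one (hvis : IsVisualized A) (h : CritWalk A l i j) :
    mpow A l i.1 j.1 = 1 := by
  refine mpow_eq_one_of_hasWalk hvis.1 ?_
  obtain ⟨σ, h0, hl, hσ⟩ := HasWalk.exists_sequence h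
  have := hasWalk_of_sequence (G := fun a b => A a b = 1) (fun k hk => hvis.2 _ _ (hσ k hk))
    (a := 0) (l := l) (by omega)
  rwa [Nat.zero_add, h0, hl] at this

/-- The edge and the return walk form a cycle of geometric mean 1, which is `lam A`. -/
theorem critEdge_of_hasWalk_weight_one (hdef : IsDefinite A) {i j : ι} {l : ℕ} (hij : A i j = 1)
    (hw : HasWalk (fun a b => A a b = 1) l j i) : CritEdge A i j := by
  obtain ⟨σ, h0, hl, hσ⟩ :=
    HasWalk.exists_sequence (G := fun a b => A a b = 1) (l := l + 1) ⟨j, hij, hw⟩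
  obtain ⟨τ, t0, tl, hτ⟩ := hw.exists_sequence
  let ρ : ℕ → ι := fun k => Nat.casesOn k i τ
  have hρ : ∀ k < l + 1, A (ρ k) (ρ (k + 1)) = 1 := by
    rintro (_ | k) hk
    · simpa [ρ, t0] using hij
    · exact hτ k (by omega)
  refine ⟨l + 1, ρ, ⟨by omega, tl, fun k hk => by simp [hρ k hk], ?_⟩, 0, by omega, rfl, t0⟩
  rw [Finset.prod_eq_one fun k hk => hρ k (Finset.mem_range.1 hk), NNReal.one_rpow, hdef]

/-- Every edge lies on the closed walk of weight 1; in the induction the edge removed in front is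
appended to the return walk. -/
theorem hasWalk_critEdge_of_weight_one (hdef : IsDefinite A) {i j : ι} {l m : ℕ}
    (h : HasWalk (fun a b => A a b = 1) l i j) (h' : HasWalk (fun a b => A a b = 1) m j i) :
    HasWalk (CritEdge A) l i j := by
  induction l generalizing i m with
  | zero => exact h
  | succ l ih =>
    obtain ⟨x, hx, hw⟩ := h
    exact ⟨x, critEdge_of_hasWalk_weight_one hdef hx (hw.append h'),
      ih hw (h'.append (hasWalk_one hx))⟩

theorem critWalk_of_mpow_eq_one (hdef : IsDefinite A) (hvis : IsVisualized A)
    (hij : comp A i = comp A j) (h : mpow A l i.1 j.1 = 1) : CritWalk A l i j := by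
  obtain ⟨m, hm⟩ := exists_critWalk_of_comp_eq hij.symm
  exact hasWalk_critEdge_of_weight_one hdef (hasWalk_of_mpow_eq_one hvis.1 h)
    (hasWalk_of_mpow_eq_one hvis.1 (hm.mpow_eq_one hvis))

variable {r : ℕ}

/-- The central estimate: walks from `x` to `u` extend to walks from `y` to `v` of the same weight,
and periodicity absorbs the added length `l + m`. -/
theorem mpow_le_of_critWalk (hvis : IsVisualized A) (hr : transient A ≤ (r : ℕ∞))
    {x y u v : CritNode A} (hyx : CritWalk A l y x) (huv : CritWalk A m u v)
    (hd : totalCyc A ∣ l + m) : mpow A r x.1 u.1 ≤ mpow A r y.1 v.1 := by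
  obtain ⟨k, hk⟩ := hd
  have h := (mul_le_mul_left (mpow_mul_le (A := A) l r y.1 x.1 u.1) (mpow A m u.1 v.1)).trans
    (mpow_mul_le (A := A) (l + r) m y.1 u.1 v.1)
  rwa [hyx.mpow_eq_one hvis, huv.mpow_eq_one hvis, one_mul, mul_one,
    show l + r + m = r + (l + m) by omega, hk,
    mpow_add_mul_period (exists_period_of_transient_le hr)] at h

theorem mpow_le_of_cls_eq (hvis : IsVisualized A) (hr : transient A ≤ (r : ℕ∞))
    {x y u v : CritNode A} (hyx : cls A y = cls A x) (huv : cls A u = cls A v) :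
    mpow A r x.1 u.1 ≤ mpow A r y.1 v.1 := by
  obtain ⟨l, hl, hld⟩ := cls_eq_iff.1 hyx
  obtain ⟨m, hm, hmd⟩ := cls_eq_iff.1 huv
  obtain ⟨l, hl, hl0⟩ := hl.exists_modEq_totalCyc (Nat.modEq_zero_iff_dvd.2 hld)
  obtain ⟨m, hm, hm0⟩ := hm.exists_modEq_totalCyc (Nat.modEq_zero_iff_dvd.2 hmd)
  exact mpow_le_of_critWalk hvis hr hl hm
    (dvd_add (Nat.modEq_zero_iff_dvd.1 hl0) (Nat.modEq_zero_iff_dvd.1 hm0))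

theorem mpow_eq_reducedEntry (hvis : IsVisualized A) (hr : transient A ≤ (r : ℕ∞))
    (i j : CritNode A) : mpow A r i.1 j.1 = reducedEntry A r (cls A i) (cls A j) :=
  le_antisymm (mpow_le_of_cls_eq hvis hr (cls A i).cls_rep (cls A j).cls_rep.symm)
    (mpow_le_of_cls_eq hvis hr (cls A i).cls_rep.symm (cls A j).cls_rep)

theorem reducedEntry_self (hvis : IsVisualized A) (hr : transient A ≤ (r : ℕ∞))
    (hdvd : totalCyc A ∣ r) (c : CycClass A) : reducedEntry A r c c = 1 := by
  obtain ⟨N, hN⟩ := exists_forall_ge_critWalk_self c.rep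
  -- Closed critical walks exist only for large lengths, so `r` is raised by a multiple of the
  -- period and brought back.
  have hle : N ≤ totalCyc A * N := Nat.le_mul_of_pos_left _ (totalCyc_pos A)
  have := (hN (r + totalCyc A * N) (by omega)
    ((cyc_dvd_totalCyc A _).trans (dvd_add hdvd (dvd_mul_right _ _)))).mpow_eq_one hvis
  rwa [mpow_add_mul_period (exists_period_of_transient_le hr)] at this

/-- As `r` is a multiple of the period, `A^(2r) = A^r`. -/
theorem reducedEntry_mul_le (hr : transient A ≤ (r : ℕ∞))
    (hdvd : totalCyc A ∣ r) (c c' c'' : CycClass A) :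
    reducedEntry A r c c' * reducedEntry A r c' c'' ≤ reducedEntry A r c c'' := by
  obtain ⟨k, hk⟩ := hdvd
  have h := mpow_mul_le (A := A) r r c.rep.1 c'.rep.1 c''.rep.1
  rwa [show r + r = r + totalCyc A * k by rw [← hk],
    mpow_add_mul_period (exists_period_of_transient_le hr)] at h

theorem reducedEntry_lt_one (hdef : IsDefinite A) (hvis : IsVisualized A)
    (hdvd : totalCyc A ∣ r) {c c' : CycClass A}
    (hcomp : c.toComp = c'.toComp) (hne : c ≠ c') : reducedEntry A r c c' < 1 := by
  refine lt_of_le_of_ne (mpow_le_one hvis.1 _ _ _) fun h => hne ?_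
  have hw : CritWalk A r c.rep c'.rep :=
    critWalk_of_mpow_eq_one hdef hvis (by rw [c.comp_rep, c'.comp_rep, hcomp]) h
  rw [← c.cls_rep, ← c'.cls_rep]
  exact cls_eq_iff.2 ⟨r, hw, (cyc_dvd_totalCyc A _).trans hdvd⟩

/-- Rows must be extended from `p` to `i`, that is, `t` places back. This is done by `(γ - 1) * t`
places forward; with the `t` places on the column side, the added length is `γ * t` mod γ, hence 0.
-/
theorem isRectCirculant_reducedBlock (hvis : IsVisualized A) (hr : transient A ≤ (r : ℕ∞))
    {μ ν : CritComp A} {s : Fin (cyc A μ) → CycClass A} {s' : Fin (cyc A ν) → CycClass A}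
    (hs : IsProperArrangement A μ s) (hs' : IsProperArrangement A ν s') :
    IsRectCirculant (reducedBlock A r s s') := by
  have back : ∀ {n a b t : ℕ}, n ∣ totalCyc A → b ≡ a + t [MOD n] →
      a ≡ b + (totalCyc A - 1) * t [MOD n] := by
    intro n a b t hn h
    have h1 := h.add_right ((totalCyc A - 1) * t)
    have h2 : a + t + (totalCyc A - 1) * t = a + totalCyc A * t := by
      obtain ⟨g, hg⟩ := Nat.exists_eq_add_of_le' (totalCyc_pos A)
      rw [hg, Nat.add_sub_cancel]
      ring
    rw [h2] at h1
    have h3 : a + totalCyc A * t ≡ a + 0 [MOD n] :=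
      (Nat.modEq_zero_iff_dvd.2 (hn.mul_right t)).add_left a
    exact (h1.trans h3).symm
  have key : ∀ (i p : Fin (cyc A μ)) (j q : Fin (cyc A ν)) (t : ℕ),
      (p : ℕ) ≡ i + t [MOD cyc A μ] → (q : ℕ) ≡ j + t [MOD cyc A ν] →
      reducedBlock A r s s' i j ≤ reducedBlock A r s s' p q := by
    intro i p j q t hp hq
    obtain ⟨l, hl, hlt⟩ := hs.exists_critWalk (back (cyc_dvd_totalCyc A μ) hp)
    obtain ⟨m, hm, hmt⟩ := hs'.exists_critWalk hq
    rw [← hs.toComp_eq p, ← CycClass.comp_rep] at hlt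
    rw [← hs'.toComp_eq j, ← CycClass.comp_rep] at hmt
    obtain ⟨l, hl, hlt⟩ := hl.exists_modEq_totalCyc hlt
    obtain ⟨m, hm, hmt⟩ := hm.exists_modEq_totalCyc hmt
    refine mpow_le_of_critWalk hvis hr hl hm (Nat.modEq_zero_iff_dvd.1 ?_)
    refine (hlt.add hmt).trans (Nat.modEq_zero_iff_dvd.2 ⟨t, ?_⟩)
    obtain ⟨g, hg⟩ := Nat.exists_eq_add_of_le' (totalCyc_pos A)
    rw [hg, Nat.add_sub_cancel]
    ring
  intro i p j q t hp hq
  -- The reverse inequality is the same one for the inverse shift `(γ - 1) * t`.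
  exact le_antisymm (key i p j q t hp hq) (key p i q j _ (back (cyc_dvd_totalCyc A μ) hp)
    (back (cyc_dvd_totalCyc A ν) hq))

theorem IsRectCirculant.exists_isBlockCirculant {μ ν : CritComp A}
    {M : Matrix (Fin (cyc A μ)) (Fin (cyc A ν)) ℝ≥0} (hM : IsRectCirculant M) :
    ∃ P : ∀ κ : CritComp A, Equiv.Perm (Fin (cyc A κ)),
      IsBlockCirculant (Nat.gcd (cyc A μ) (cyc A ν)) (M.submatrix (P μ) (P ν)) := by
  -- The permutation is chosen per component, so that rows and columns share it when `μ = ν`. Where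
  -- the gcd does not divide `cyc A κ`, any permutation will do.
  have h : ∀ κ : CritComp A, ∃ P : Equiv.Perm (Fin (cyc A κ)),
      Nat.gcd (cyc A μ) (cyc A ν) ∣ cyc A κ →
      ∃ ρ : Fin (cyc A κ) → Fin (Nat.gcd (cyc A μ) (cyc A ν)),
        Monotone ρ ∧ Function.Surjective ρ ∧ ∀ i,
          ((P i : ℕ) : ZMod (Nat.gcd (cyc A μ) (cyc A ν))) = ((ρ i : ℕ) : ZMod _) := by
    intro κ
    by_cases hd : Nat.gcd (cyc A μ) (cyc A ν) ∣ cyc A κ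
    · obtain ⟨P, ρ, hρ⟩ := exists_perm_grouping_residues (cyc_pos A κ) hd
      exact ⟨P, fun _ => ⟨ρ, hρ⟩⟩
    · exact ⟨1, fun h => absurd h hd⟩
  choose P hP using h
  obtain ⟨ρ, hρ, hρs, hPρ⟩ := hP μ (Nat.gcd_dvd_left _ _)
  obtain ⟨κ, hκ, hκs, hPκ⟩ := hP ν (Nat.gcd_dvd_right _ _)
  obtain ⟨α, hα⟩ := hM.exists_diagonal rfl
  refine ⟨P, α, ρ, κ, hρ, hρs, hκ, hκs, fun i j => ?_⟩
  rw [Matrix.submatrix_apply, hα, hPρ, hPκ]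

end CriticalGraph

end MaxAlg

open MaxAlg in
theorem proposition5p5 (n : ℕ) (A : Matrix (Fin n) (Fin n) ℝ≥0)
    (hirr : IsIrred A) (hdef : IsDefinite A) (hvis : IsVisualized A)
    (r : ℕ) (hr : transient A ≤ (r : ℕ∞)) :
    -- the power is constant on products of cyclic classes, so the reduced matrix is well defined
    (∀ i j : CritNode A, mpow A r i.1 j.1 = reducedEntry A r (cls A i) (cls A j)) ∧
    -- the cyclic classes of every component can be properly arranged
    (∀ μ : CritComp A, ∃ s : Fin (cyc A μ) → CycClass A, IsProperArrangement A μ s) ∧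
    -- for all proper arrangements
    ∀ s : ∀ μ : CritComp A, Fin (cyc A μ) → CycClass A,
      (∀ μ, IsProperArrangement A μ (s μ)) →
      (∀ μ ν, IsRectCirculant (reducedBlock A r (s μ) (s ν))) ∧
      (∀ μ, IsCirculant (reducedBlock A r (s μ) (s μ))) ∧
      (∀ μ ν, ∃ P : ∀ κ : CritComp A, Equiv.Perm (Fin (cyc A κ)),
        IsBlockCirculant (Nat.gcd (cyc A μ) (cyc A ν))
          ((reducedBlock A r (s μ) (s ν)).submatrix (P μ) (P ν))) ∧
      (totalCyc A ∣ r → ∀ μ,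
        IsCirculant (reducedBlock A r (s μ) (s μ)) ∧
        IsKleeneStar (reducedBlock A r (s μ) (s μ)) ∧
        ∀ a b, a ≠ b → reducedBlock A r (s μ) (s μ) a b < 1) := by
  refine ⟨mpow_eq_reducedEntry hvis hr, exists_isProperArrangement A, fun s hs => ?_⟩
  have hrect : ∀ μ ν, IsRectCirculant (reducedBlock A r (s μ) (s ν)) :=
    fun μ ν => isRectCirculant_reducedBlock hvis hr (hs μ) (hs ν)
  refine ⟨hrect, fun μ => (hrect μ μ).isCirculant,
    fun μ ν => (hrect μ ν).exists_isBlockCirculant, fun hdvd μ => ⟨(hrect μ μ).isCirculant,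
      isKleeneStar_of_idempotent (fun a => reducedEntry_self hvis hr hdvd _)
        (fun a b c => reducedEntry_mul_le hr hdvd _ _ _), fun a b hab => ?_⟩⟩
  exact reducedEntry_lt_one hdef hvis hdvd
    (((hs μ).toComp_eq a).trans ((hs μ).toComp_eq b).symm) fun h => hab ((hs μ).1 h)
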